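/- **Setting.** There are $n\ge 1$ voters and $m\ge 1$ alternatives. A preference profile $\boldsymbol\sigma=(\sigma_1,\dots,\sigma_n)$ consists of a strict ranking $\sigma_i$ of the alternatives for each voter $i$; a (deterministic) voting rule $f$ maps each profile to an alternative $f(\boldsymbol\sigma)$. Given a probability distribution $\mathcal D$ on $[0,1]$ and a profile $\boldsymbol\sigma$, random utilities are generated as follows: each voter $i$ independently makes $m$ i.i.d. draws from $\mathcal D$, and these are assigned from highest to lowest to the alternatives in the order of $\sigma_i$, which gives $u_{ij}$. Put $\mathrm{sw}(j)=\sum_i u_{ij}$ and $$\mathrm{dist}(f,\boldsymbol\sigma)=\frac{\mathrm{sw}(f(\boldsymbol\sigma))}{\max_j \mathrm{sw}(j)}$$ (with value $0$ when all utilities are $0$). An EDMR is a voting rule that, for every $\boldsymbol\sigma$, maximizes $\mathbb E[\mathrm{dist}(\cdot,\boldsymbol\sigma)]$ over all voting rules. A voting rule $f$ is an $\alpha$-EDMR for $\mathcal D$ if $\mathbb E[\mathrm{dist}(f,\boldsymbol\sigma)]\ge \alpha\cdot\mathbb E[\mathrm{dist}(\mathrm{EDMR},\boldsymbol\sigma)]$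 for all profiles $\boldsymbol\sigma$. Binomial voting awards $\sum_{\ell=k}^m\binom m\ell$ points to an alternative for each voter who ranks it $k$-th ($k=1$ is the top) and selects an alternative with the highest total, ties being broken arbitrarily. The largest median of $\mathcal D$ is $\nu=\sup\{y : \Pr_{x\sim\mathcal D}(x\le y)\le \tfrac12\}$. **Corollary.** Let $\mu,s^2,\nu$ be fixed real numbers and $\varepsilon>0$. 1. There exists $n_0$, depending only on $\mu,s^2,\nu,\varepsilon$, such that for every distribution $\mathcal D$ supported on $[0,1]$ with mean $\mu$, variance $s^2$ and largest median $\nu$, every $n\ge n_0$ and every $m$, binomial voting (under any tie-breaking) is a $\bigl(\tfrac12-\varepsilon\bigr)\nu$-EDMR for $\mathcal D$. 2. Furthermore, let $\mathcal D$ be a distribution supported on $[0,1]$ with mean $\mu$, variance $s^2$ and largest median $\nu$, whose CDF $F$ is continuous, and continuously differentiable on $(0,1)$ with $\inf_{0<x<1}F'(x)>0$. Then there exists $m_0$ such that for every $m\ge m_0$ and every $n$, binomial voting (under any tie-breaking) is a $\bigl(\tfrac12-\varepsilon\bigr)\nu$-EDMR for $\mathcal D$. -/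

import Mathlib

open MeasureTheory ProbabilityTheory

namespace DistVoting

/-- A preference profile of `n` voters over `m` alternatives. `σ i j` is the position that voter `i`
gives to alternative `j`; position `0` is the top of the ranking and `m - 1` its bottom. -/
abbrev Profile (n m : ℕ) : Type := Fin n → Equiv.Perm (Fin m)

/-- A deterministic voting rule: it maps each preference profile to a winning alternative. -/
abbrev VotingRule (n m : ℕ) : Type := Profile n m → Fin m

/-- Social welfare of alternative `j` under the utility profile `u`. -/
noncomputable def socialWelfare {n m : ℕ} (u : Fin n → Fin m → ℝ) (j : Fin m) : ℝ :=
  ∑ i, u i j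

/-- The `k`-th largest entry of `x`, counted from `k = 0` (the largest one), with multiplicity.
(`x ∘ Tuple.sort x` lists the entries of `x` in nondecreasing order.) -/
noncomputable def kthLargest {m : ℕ} (x : Fin m → ℝ) (k : Fin m) : ℝ :=
  x (Tuple.sort x k.rev)

/-- The utility profile consistent with `σ` that arises from the draws `X`: the `m` numbers drawn by
voter `i` are assigned from highest to lowest to the alternatives in the order of the ranking of
voter `i`. -/
noncomputable def utilities {n m : ℕ} (σ : Profile n m) (X : Fin n → Fin m → ℝ) :
    Fin n → Fin m → ℝ :=
  fun i j => kthLargest (X i) (σ i j)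

/-- The law of the draws: each of `n` voters draws `m` numbers, all i.i.d. from `D`. -/
noncomputable def drawLaw (D : Measure ℝ) (n m : ℕ) : Measure (Fin n → Fin m → ℝ) :=
  Measure.pi fun _ => Measure.pi fun _ => D

/-- The distributional distortion of the rule `f` at `σ`, as a random variable of the draws `X`
(with value `0` where all alternatives have welfare `0`). -/
noncomputable def distortion {n m : ℕ} (f : VotingRule n m) (σ : Profile n m)
    (X : Fin n → Fin m → ℝ) : ℝ :=
  socialWelfare (utilities σ X) (f σ) / ⨆ j : Fin m, socialWelfare (utilities σ X) j

/-- The expected distortion of the rule `f` at `σ`. -/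
noncomputable def expectedDistortion {n m : ℕ} (D : Measure ℝ) (f : VotingRule n m)
    (σ : Profile n m) : ℝ :=
  ∫ X, distortion f σ X ∂(drawLaw D n m)

/-- `e` is an expected-distortion-maximizing rule for `D`. -/
def IsEDMR {n m : ℕ} (D : Measure ℝ) (e : VotingRule n m) : Prop :=
  ∀ (σ : Profile n m) (g : VotingRule n m), expectedDistortion D g σ ≤ expectedDistortion D e σ

/-- `f` is an `α`-expected-distortion-maximizing rule for `D`. -/
def IsApproxEDMR {n m : ℕ} (α : ℝ) (D : Measure ℝ) (f : VotingRule n m) : Prop :=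
  ∀ e : VotingRule n m, IsEDMR D e →
    ∀ σ : Profile n m, α * expectedDistortion D e σ ≤ expectedDistortion D f σ

/-- Total score of alternative `j` when position `k` is worth `s k` points. -/
noncomputable def totalScore {n m : ℕ} (s : Fin m → ℝ) (σ : Profile n m) (j : Fin m) : ℝ :=
  ∑ i, s (σ i j)

/-- `f` is a scoring rule with score vector `s`: it always selects an alternative of highest total
score (ties may be broken in any way). -/
def IsScoringRule {n m : ℕ} (s : Fin m → ℝ) (f : VotingRule n m) : Prop :=
  ∀ (σ : Profile n m) (j : Fin m), totalScore s σ j ≤ totalScore s σ (f σ)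

/-- `f` is binomial voting: the alternative in the `k`-th place (`k = 1, …, m`) of a ranking gets
`∑ ℓ = k, …, m` of `m.choose ℓ` points. Place `k` is position `k - 1`. -/
def IsBinomialVoting {n m : ℕ} (f : VotingRule n m) : Prop :=
  IsScoringRule (fun p : Fin m => ∑ l ∈ Finset.Icc ((p : ℕ) + 1) m, (m.choose l : ℝ)) f

/-- The largest median of `D`. -/
noncomputable def largestMedian (D : Measure ℝ) : ℝ :=
  sSup {y : ℝ | cdf D y ≤ 1 / 2}

/-- The CDF of a distribution on `[0,1]` is continuous, continuously differentiable on `(0,1)`, and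
its derivative there is bounded away from `0`. -/
def HasC1CdfBoundedBelow (D : Measure ℝ) : Prop :=
  Continuous (fun x : ℝ => cdf D x) ∧
  ContDiffOn ℝ 1 (fun x : ℝ => cdf D x) (Set.Ioo 0 1) ∧
  ∃ c : ℝ, 0 < c ∧ ∀ x ∈ Set.Ioo (0 : ℝ) 1, c ≤ deriv (fun t : ℝ => cdf D t) x

/-- Expected-distortion-maximizing rules exist. -/
theorem exists_isEDMR {n m : ℕ} (hm : 1 ≤ m) (D : Measure ℝ) :
    ∃ e : VotingRule n m, IsEDMR D e := by
  have : Nonempty (Fin m) := ⟨⟨0, hm⟩⟩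
  choose e he using fun σ : Profile n m =>
    Finite.exists_max fun j : Fin m => expectedDistortion D (fun _ => j) σ
  exact ⟨e, fun σ g => he σ (g σ)⟩

/-- Every score vector has a scoring rule; in particular binomial voting exists. -/
theorem exists_isScoringRule {n m : ℕ} (hm : 1 ≤ m) (s : Fin m → ℝ) :
    ∃ f : VotingRule n m, IsScoringRule s f := by
  have : Nonempty (Fin m) := ⟨⟨0, hm⟩⟩
  choose f hf using fun σ : Profile n m => Finite.exists_max fun j : Fin m => totalScore s σ j
  exact ⟨f, hf⟩

end DistVoting

open MeasureTheory ProbabilityTheory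

namespace DistVoting

/-! No rule has expected distortion above 1, so it suffices that binomial voting achieves at least
ν/2, where ν is the largest median. This holds for all positive n and m. A draw is at least ν with
probability at least 1/2. Hence the k-th largest of m draws is at least ν with probability at least
P(Bin(m, 1/2) ≥ k), which is the binomial score of place k divided by 2^m
(`binomialTail_le_measureReal_card`). By Markov's inequality the expected utility of that place is
at least ν times this normalized score. By the symmetry of the binomial distribution the scores
average 2^m / 2 over the places, and the winner has at least the average total, so its expected
welfare is at least nν/2 (`IsBinomialVoting.le_integral_socialWelfare`). Utilities are at most 1, so
the best welfare is at most n, and dividing by n gives the bound. -/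

/-! ### Order statistics and measurability -/

theorem le_kthLargest_iff {m : ℕ} (x : Fin m → ℝ) (k : Fin m) (t : ℝ) :
    t ≤ kthLargest x k ↔ (k : ℕ) + 1 ≤ (Finset.univ.filter fun i => t ≤ x i).card := by
  have hcard : (Finset.univ.filter fun i => t ≤ x i).card
      = (Finset.univ.filter fun i => t ≤ x (Tuple.sort x i)).card :=
    (Finset.card_equiv (Tuple.sort x) (by simp)).symm
  have hmono : Monotone (x ∘ Tuple.sort x) := Tuple.monotone_sort x
  have hk := k.isLt
  rw [hcard]
  constructor
  · intro h
    -- In sorted order the entries that are at least `t` form a final segment; `Finset.Ici k.rev`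
    -- has `k + 1` elements and `Finset.Ioi k.rev` has `k`.
    have hsub : Finset.Ici k.rev ⊆ Finset.univ.filter fun i => t ≤ x (Tuple.sort x i) := by
      intro i hi
      simp only [Finset.mem_filter, Finset.mem_univ, true_and]
      exact h.trans (hmono (Finset.mem_Ici.1 hi))
    have := Finset.card_le_card hsub
    rw [Fin.card_Ici, Fin.val_rev] at this
    omega
  · intro h
    by_contra hlt
    have hsub : (Finset.univ.filter fun i => t ≤ x (Tuple.sort x i)) ⊆ Finset.Ioi k.rev := by
      intro i hi
      simp only [Finset.mem_filter, Finset.mem_univ, true_and] at hi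
      rw [Finset.mem_Ioi]
      by_contra hik
      exact hlt (hi.trans (hmono (not_lt.1 hik)))
    have := Finset.card_le_card hsub
    rw [Fin.card_Ioi, Fin.val_rev] at this
    omega

theorem measurable_card_filter_le {m : ℕ} (t : ℝ) :
    Measurable fun x : Fin m → ℝ => (Finset.univ.filter fun i => t ≤ x i).card := by
  simp only [Finset.card_filter]
  refine Finset.measurable_fun_sum _ fun i _ => Measurable.ite ?_ measurable_const measurable_const
  exact measurableSet_le measurable_const (measurable_pi_apply i)

theorem measurable_kthLargest {m : ℕ} (k : Fin m) :
    Measurable fun x : Fin m → ℝ => kthLargest x k := by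
  refine measurable_of_Ici fun t => ?_
  have : (fun x : Fin m → ℝ => kthLargest x k) ⁻¹' Set.Ici t
      = (fun x : Fin m → ℝ => (Finset.univ.filter fun i => t ≤ x i).card) ⁻¹'
        Set.Ici ((k : ℕ) + 1) := by
    ext x
    exact le_kthLargest_iff x k t
  rw [this]
  exact measurable_card_filter_le t measurableSet_Ici

theorem measurable_socialWelfare_utilities {n m : ℕ} (σ : Profile n m) (j : Fin m) :
    Measurable fun X : Fin n → Fin m → ℝ => socialWelfare (utilities σ X) j :=
  Finset.measurable_fun_sum _ fun i _ => (measurable_kthLargest (σ i j)).comp (measurable_pi_apply i)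

theorem measurable_distortion {n m : ℕ} (f : VotingRule n m) (σ : Profile n m) :
    Measurable (distortion f σ) :=
  (measurable_socialWelfare_utilities σ (f σ)).div
    (Measurable.iSup fun j => measurable_socialWelfare_utilities σ j)

/-! ### Binomial tails and stochastic domination -/

/-- The number of subsets of an `m`-element set that have at least `k` elements. -/
noncomputable def binomialTail (m k : ℕ) : ℝ := ∑ l ∈ Finset.Icc k m, (m.choose l : ℝ)

theorem binomialTail_zero_right (m : ℕ) : binomialTail m 0 = 2 ^ m := by
  have := Nat.sum_range_choose m
  unfold binomialTail
  rw [← Nat.range_succ_eq_Icc_zero]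
  exact_mod_cast this

/-- Pascal's rule: split the subsets by whether they contain a fixed element. -/
theorem binomialTail_succ_succ (m k : ℕ) :
    binomialTail (m + 1) (k + 1) = binomialTail m k + binomialTail m (k + 1) := by
  have hshift (g : ℕ → ℝ) :
      ∑ l ∈ Finset.Icc (k + 1) (m + 1), g l = ∑ l ∈ Finset.Icc k m, g (l + 1) := by
    rw [← Finset.map_add_right_Icc k m 1, Finset.sum_map]
    rfl
  have hlast : binomialTail m (k + 1) = ∑ l ∈ Finset.Icc (k + 1) (m + 1), (m.choose l : ℝ) := by
    refine Finset.sum_subset (Finset.Icc_subset_Icc_right (Nat.le_succ m)) fun l hl hl' => ?_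
    rw [Nat.choose_eq_zero_of_lt, Nat.cast_zero]
    simp only [Finset.mem_Icc] at hl hl'
    omega
  rw [hlast, hshift]
  unfold binomialTail
  rw [hshift, ← Finset.sum_add_distrib]
  exact Finset.sum_congr rfl fun l _ => by rw [Nat.choose_succ_succ', Nat.cast_add]

/-- Complementation turns subsets with at least `p` elements into those with fewer than `q`. The
induction uses Pascal's rule instead, with the endpoints `p = 0` and `q = 0` treated apart. -/
theorem binomialTail_add_binomialTail {m p q : ℕ} (h : p + q = m + 1) :
    binomialTail m p + binomialTail m q = 2 ^ m := by
  induction m generalizing p q with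
  | zero =>
    obtain ⟨rfl, rfl⟩ | ⟨rfl, rfl⟩ : p = 0 ∧ q = 1 ∨ p = 1 ∧ q = 0 := by omega
    all_goals simp [binomialTail]
  | succ m ih =>
    have hend (r : ℕ) : binomialTail r (r + 1) = 0 := by simp [binomialTail]
    rcases p with _ | p
    · rw [zero_add] at h
      rw [h, hend, binomialTail_zero_right, add_zero]
    rcases q with _ | q
    · rw [add_zero] at h
      rw [h, hend, binomialTail_zero_right, zero_add]
    rw [binomialTail_succ_succ, binomialTail_succ_succ]
    have h1 := ih (p := p) (q := q + 1) (by omega)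
    have h2 := ih (p := p + 1) (q := q) (by omega)
    rw [pow_succ]
    linarith

theorem sum_binomialTail (m : ℕ) :
    ∑ p : Fin m, binomialTail m ((p : ℕ) + 1) = m * 2 ^ m / 2 := by
  have hrev : ∑ p : Fin m, binomialTail m ((p.rev : ℕ) + 1)
      = ∑ p : Fin m, binomialTail m ((p : ℕ) + 1) :=
    Equiv.sum_comp Fin.revPerm fun p : Fin m => binomialTail m ((p : ℕ) + 1)
  have hadd : ∑ p : Fin m, (binomialTail m ((p : ℕ) + 1) + binomialTail m ((p.rev : ℕ) + 1))
      = m * 2 ^ m := by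
    rw [Finset.sum_congr rfl fun p _ => binomialTail_add_binomialTail
      (by rw [Fin.val_rev]; have := p.isLt; omega)]
    simp
  rw [Finset.sum_add_distrib, hrev] at hadd
  linarith

/-- If a draw is at least `t` with probability at least `1 / 2`, then the number of draws that are
at least `t` dominates the binomial distribution with parameter `1 / 2`. -/
theorem binomialTail_le_measureReal_card (D : Measure ℝ) [IsProbabilityMeasure D] (t : ℝ)
    (ht : 1 / 2 ≤ D.real (Set.Ici t)) (m k : ℕ) :
    binomialTail m k / 2 ^ m ≤ (Measure.pi fun _ : Fin m => D).real
      {x | k ≤ (Finset.univ.filter fun i => t ≤ x i).card} := by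
  induction m generalizing k with
  | zero =>
    rcases k with _ | k <;> simp [binomialTail]
  | succ m ih =>
    rcases k with _ | k
    · simp [binomialTail_zero_right]
    set P := Measure.pi fun _ : Fin m => D
    let S (k : ℕ) : Set (Fin m → ℝ) := {x | k ≤ (Finset.univ.filter fun i => t ≤ x i).card}
    have hS (k : ℕ) : MeasurableSet (S k) := measurable_card_filter_le t measurableSet_Ici
    -- Condition on whether the first draw reaches `t`.
    have hpre : {x : Fin (m + 1) → ℝ | k + 1 ≤ (Finset.univ.filter fun i => t ≤ x i).card}
        = MeasurableEquiv.piFinSuccAbove (fun _ => ℝ) 0 ⁻¹'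
          (Set.Ici t ×ˢ S k ∪ (Set.Ici t)ᶜ ×ˢ S (k + 1)) := by
      ext x
      have hcard : (Finset.univ.filter fun i => t ≤ x i).card
          = (if t ≤ x 0 then 1 else 0) + (Finset.univ.filter fun i : Fin m => t ≤ x i.succ).card := by
        rw [Finset.card_filter, Finset.card_filter, Fin.sum_univ_succ]
      change k + 1 ≤ _ ↔
        t ≤ x 0 ∧ k ≤ (Finset.univ.filter fun i : Fin m => t ≤ x i.succ).card ∨
          ¬ t ≤ x 0 ∧ k + 1 ≤ (Finset.univ.filter fun i : Fin m => t ≤ x i.succ).card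
      rw [hcard]
      by_cases h : t ≤ x 0
      · rw [if_pos h]
        simp only [h, true_and, not_true_eq_false, false_and, or_false]
        omega
      · rw [if_neg h]
        simp only [h, false_and, not_false_eq_true, true_and, false_or]
        omega
    have hmp := measurePreserving_piFinSuccAbove (fun _ : Fin (m + 1) => D) 0
    have hdisj : Disjoint (Set.Ici t ×ˢ S k) ((Set.Ici t)ᶜ ×ˢ S (k + 1)) :=
      Set.Disjoint.set_prod_left disjoint_compl_right _ _
    have hmeas : MeasurableSet ((Set.Ici t)ᶜ ×ˢ S (k + 1)) :=
      measurableSet_Ici.compl.prod (hS (k + 1))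
    have hval : (Measure.pi fun _ : Fin (m + 1) => D).real
          {x | k + 1 ≤ (Finset.univ.filter fun i => t ≤ x i).card}
        = D.real (Set.Ici t) * P.real (S k) + (1 - D.real (Set.Ici t)) * P.real (S (k + 1)) := by
      rw [hpre, measureReal_def, hmp.measure_preimage
        ((measurableSet_Ici.prod (hS k)).union hmeas).nullMeasurableSet, ← measureReal_def,
        measureReal_union hdisj hmeas, measureReal_prod_prod, measureReal_prod_prod,
        probReal_compl_eq_one_sub measurableSet_Ici]
    have hanti : P.real (S (k + 1)) ≤ P.real (S k) :=
      measureReal_mono fun x hx => (Nat.le_succ k).trans hx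
    rw [hval, binomialTail_succ_succ]
    have h1 : binomialTail m k / 2 ^ m ≤ P.real (S k) := ih k
    have h2 : binomialTail m (k + 1) / 2 ^ m ≤ P.real (S (k + 1)) := ih (k + 1)
    have h3 : (binomialTail m k + binomialTail m (k + 1)) / 2 ^ (m + 1)
        = (binomialTail m k / 2 ^ m + binomialTail m (k + 1) / 2 ^ m) / 2 := by
      rw [pow_succ]
      field_simp
    rw [h3]
    -- The mixture of the two probabilities increases with the weight on the larger one, so weight
    -- 1/2 gives a lower bound.
    nlinarith [mul_nonneg (sub_nonneg.2 ht) (sub_nonneg.2 hanti)]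

/-! ### The largest median -/

theorem cdf_eq_zero_of_neg {D : Measure ℝ} [IsProbabilityMeasure D]
    (hD : ∀ᵐ x ∂D, x ∈ Set.Icc (0 : ℝ) 1) {y : ℝ} (hy : y < 0) : cdf D y = 0 := by
  rw [cdf_eq_real, measureReal_eq_zero_iff]
  have hsub : Set.Iic y ⊆ {x | x ∉ Set.Icc (0 : ℝ) 1} :=
    fun x hx hx' => absurd (hx'.1.trans hx) (not_le.2 hy)
  exact measure_mono_null hsub hD

theorem bddAbove_cdf_le_half {D : Measure ℝ} [IsProbabilityMeasure D]
    (hD : ∀ᵐ x ∂D, x ∈ Set.Icc (0 : ℝ) 1) : BddAbove {y : ℝ | cdf D y ≤ 1 / 2} := by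
  refine ⟨1, fun y hy => ?_⟩
  by_contra hlt
  have h1 : cdf D y = 1 := by
    have hae : ∀ᵐ x ∂D, x ∈ Set.Iic y := by
      filter_upwards [hD] with x hx using hx.2.trans (not_le.1 hlt).le
    rw [cdf_eq_real, measureReal_def, (mem_ae_iff_prob_eq_one measurableSet_Iic).1 hae,
      ENNReal.toReal_one]
  rw [Set.mem_ofPred_eq, h1] at hy
  norm_num at hy

theorem largestMedian_nonneg {D : Measure ℝ} [IsProbabilityMeasure D]
    (hD : ∀ᵐ x ∂D, x ∈ Set.Icc (0 : ℝ) 1) : 0 ≤ largestMedian D := by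
  refine le_of_forall_lt fun y hy => ?_
  obtain ⟨z, hyz, hz⟩ := exists_between hy
  refine hyz.trans_le (le_csSup (bddAbove_cdf_le_half hD) ?_)
  rw [Set.mem_ofPred_eq, cdf_eq_zero_of_neg hD hz]
  norm_num

/-- The CDF is at most 1/2 strictly below the largest median, hence so is its left limit there, even
if an atom makes the CDF jump at that point. -/
theorem half_le_measureReal_Ici_largestMedian {D : Measure ℝ} [IsProbabilityMeasure D]
    (hD : ∀ᵐ x ∂D, x ∈ Set.Icc (0 : ℝ) 1) : 1 / 2 ≤ D.real (Set.Ici (largestMedian D)) := by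
  have hne : {y : ℝ | cdf D y ≤ 1 / 2}.Nonempty :=
    ⟨-1, by rw [Set.mem_ofPred_eq, cdf_eq_zero_of_neg hD (by norm_num)]; norm_num⟩
  have hlt (y : ℝ) (hy : y < largestMedian D) : cdf D y ≤ 1 / 2 := by
    obtain ⟨z, hz, hyz⟩ := exists_lt_of_lt_csSup hne hy
    exact (monotone_cdf D hyz.le).trans hz
  have hleft : Function.leftLim (cdf D) (largestMedian D) ≤ 1 / 2 :=
    le_of_tendsto ((monotone_cdf D).tendsto_leftLim _)
      (Filter.eventually_of_mem self_mem_nhdsWithin hlt)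
  have hIci := (cdf D).measure_Ici (tendsto_cdf_atTop D) (largestMedian D)
  rw [measure_cdf] at hIci
  rw [measureReal_def, hIci, ENNReal.toReal_ofReal (by linarith)]
  linarith

/-! ### Random utilities and their expectations -/

theorem measurePreserving_eval_drawLaw (D : Measure ℝ) [IsProbabilityMeasure D] (n m : ℕ)
    (i : Fin n) :
    MeasurePreserving (Function.eval i) (drawLaw D n m) (Measure.pi fun _ : Fin m => D) :=
  measurePreserving_eval (fun _ : Fin n => Measure.pi fun _ : Fin m => D) i

instance isProbabilityMeasure_drawLaw (D : Measure ℝ) [IsProbabilityMeasure D] (n m : ℕ) :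
    IsProbabilityMeasure (drawLaw D n m) := by
  unfold drawLaw
  infer_instance

theorem ae_drawLaw_mem_Icc {D : Measure ℝ} [IsProbabilityMeasure D]
    (hD : ∀ᵐ x ∂D, x ∈ Set.Icc (0 : ℝ) 1) (n m : ℕ) :
    ∀ᵐ X ∂(drawLaw D n m), ∀ i k, X i k ∈ Set.Icc (0 : ℝ) 1 := by
  have hpi : ∀ᵐ x ∂(Measure.pi fun _ : Fin m => D), ∀ k, x k ∈ Set.Icc (0 : ℝ) 1 :=
    ae_all_iff.2 fun k =>
      (measurePreserving_eval (fun _ : Fin m => D) k).quasiMeasurePreserving.ae hD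
  exact ae_all_iff.2 fun i =>
    (measurePreserving_eval_drawLaw D n m i).quasiMeasurePreserving.ae hpi

theorem ae_utilities_mem_Icc {D : Measure ℝ} [IsProbabilityMeasure D]
    (hD : ∀ᵐ x ∂D, x ∈ Set.Icc (0 : ℝ) 1) {n m : ℕ} (σ : Profile n m) :
    ∀ᵐ X ∂(drawLaw D n m), ∀ i j, utilities σ X i j ∈ Set.Icc (0 : ℝ) 1 := by
  filter_upwards [ae_drawLaw_mem_Icc hD n m] with X hX i j using hX i _

theorem integrable_utilities {D : Measure ℝ} [IsProbabilityMeasure D]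
    (hD : ∀ᵐ x ∂D, x ∈ Set.Icc (0 : ℝ) 1) {n m : ℕ} (σ : Profile n m) (i : Fin n) (j : Fin m) :
    Integrable (fun X => utilities σ X i j) (drawLaw D n m) := by
  refine Integrable.of_mem_Icc 0 1 ?_ ?_
  · exact ((measurable_kthLargest (σ i j)).comp (measurable_pi_apply i)).aemeasurable
  · filter_upwards [ae_utilities_mem_Icc hD σ] with X hX using hX i j

/-- The expected utility of a position is at least the largest median times the normalized binomial
score of that position. -/
theorem largestMedian_mul_binomialTail_le_integral_utilities {D : Measure ℝ}
    [IsProbabilityMeasure D] (hD : ∀ᵐ x ∂D, x ∈ Set.Icc (0 : ℝ) 1) {n m : ℕ} (σ : Profile n m)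
    (i : Fin n) (j : Fin m) :
    largestMedian D * (binomialTail m ((σ i j : ℕ) + 1) / 2 ^ m)
      ≤ ∫ X, utilities σ X i j ∂(drawLaw D n m) := by
  set ν := largestMedian D
  have hmarkov := mul_meas_ge_le_integral_of_nonneg
    (by filter_upwards [ae_utilities_mem_Icc hD σ] with X hX using (hX i j).1)
    (integrable_utilities hD σ i j) ν
  refine le_trans (mul_le_mul_of_nonneg_left ?_ (largestMedian_nonneg hD)) hmarkov
  refine (binomialTail_le_measureReal_card D ν (half_le_measureReal_Ici_largestMedian hD) m
    ((σ i j : ℕ) + 1)).trans_eq ?_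
  have hmeas : MeasurableSet
      {x : Fin m → ℝ | (σ i j : ℕ) + 1 ≤ (Finset.univ.filter fun k => ν ≤ x k).card} :=
    measurable_card_filter_le ν measurableSet_Ici
  -- The event depends only on the draws of voter `i`, so it is pulled back along that coordinate.
  rw [measureReal_def, measureReal_def,
    ← (measurePreserving_eval_drawLaw D n m i).measure_preimage hmeas.nullMeasurableSet]
  congr 2
  ext X
  exact (le_kthLargest_iff (X i) (σ i j) ν).symm

/-! ### Averaging of scores -/

theorem sum_totalScore {n m : ℕ} (s : Fin m → ℝ) (σ : Profile n m) :
    ∑ j, totalScore s σ j = n * ∑ p, s p := by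
  unfold totalScore
  rw [Finset.sum_comm, Finset.sum_congr rfl fun i _ => Equiv.sum_comp (σ i) s]
  simp

/-- The winner of a scoring rule has at least the average total score. -/
theorem IsScoringRule.average_le {n m : ℕ} {s : Fin m → ℝ} {f : VotingRule n m}
    (hf : IsScoringRule s f) (σ : Profile n m) :
    n * ∑ p, s p ≤ m * totalScore s σ (f σ) := by
  rw [← sum_totalScore s σ]
  refine (Finset.sum_le_card_nsmul _ _ _ fun j _ => hf σ j).trans_eq ?_
  simp

theorem IsBinomialVoting.le_integral_socialWelfare {n m : ℕ} (hm : 1 ≤ m) {f : VotingRule n m}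
    (hf : IsBinomialVoting f) {D : Measure ℝ} [IsProbabilityMeasure D]
    (hD : ∀ᵐ x ∂D, x ∈ Set.Icc (0 : ℝ) 1) (σ : Profile n m) :
    n * (largestMedian D / 2)
      ≤ ∫ X, socialWelfare (utilities σ X) (f σ) ∂(drawLaw D n m) := by
  unfold socialWelfare
  rw [integral_finsetSum _ fun i _ => integrable_utilities hD σ i (f σ)]
  refine le_trans ?_ (Finset.sum_le_sum fun i _ =>
    largestMedian_mul_binomialTail_le_integral_utilities hD σ i (f σ))
  rw [← Finset.mul_sum, ← Finset.sum_div]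
  have havg : (n : ℝ) * ∑ p : Fin m, binomialTail m ((p : ℕ) + 1)
      ≤ m * ∑ i, binomialTail m ((σ i (f σ) : ℕ) + 1) := IsScoringRule.average_le hf σ
  rw [sum_binomialTail] at havg
  have hm' : (0 : ℝ) < m := by exact_mod_cast hm
  have hscore : (n : ℝ) / 2 ≤ (∑ i, binomialTail m ((σ i (f σ) : ℕ) + 1)) / 2 ^ m := by
    rw [le_div_iff₀ (by positivity)]
    refine le_of_mul_le_mul_left ?_ hm'
    linarith
  have := mul_le_mul_of_nonneg_left hscore (largestMedian_nonneg hD)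
  linarith

/-! ### Bounds on the distortion -/

section Distortion

variable {n m : ℕ} {σ : Profile n m} {X : Fin n → Fin m → ℝ}

theorem socialWelfare_nonneg (h : ∀ i j, utilities σ X i j ∈ Set.Icc (0 : ℝ) 1) (j : Fin m) :
    0 ≤ socialWelfare (utilities σ X) j :=
  Finset.sum_nonneg fun i _ => (h i j).1

theorem socialWelfare_le_card (h : ∀ i j, utilities σ X i j ∈ Set.Icc (0 : ℝ) 1) (j : Fin m) :
    socialWelfare (utilities σ X) j ≤ n :=
  (Finset.sum_le_card_nsmul _ _ 1 fun i _ => (h i j).2).trans_eq (by simp)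

theorem socialWelfare_le_iSup (u : Fin n → Fin m → ℝ) (j : Fin m) :
    socialWelfare u j ≤ ⨆ j, socialWelfare u j :=
  le_ciSup (Set.finite_range _).bddAbove j

theorem distortion_mem_Icc (f : VotingRule n m)
    (h : ∀ i j, utilities σ X i j ∈ Set.Icc (0 : ℝ) 1) : distortion f σ X ∈ Set.Icc (0 : ℝ) 1 :=
  ⟨div_nonneg (socialWelfare_nonneg h _) ((socialWelfare_nonneg h _).trans
      (socialWelfare_le_iSup _ (f σ))),
    div_le_one_of_le₀ (socialWelfare_le_iSup _ _) ((socialWelfare_nonneg h _).trans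
      (socialWelfare_le_iSup _ (f σ)))⟩

theorem socialWelfare_div_card_le_distortion (f : VotingRule n m)
    (h : ∀ i j, utilities σ X i j ∈ Set.Icc (0 : ℝ) 1) :
    socialWelfare (utilities σ X) (f σ) / n ≤ distortion f σ X := by
  have : Nonempty (Fin m) := ⟨f σ⟩
  -- If the winner's welfare is 0, the maximum may vanish too; otherwise it is positive and can be
  -- replaced by `n` in the denominator.
  rcases (socialWelfare_nonneg h (f σ)).eq_or_lt with h0 | hpos
  · rw [← h0, zero_div]
    exact (distortion_mem_Icc f h).1
  · exact div_le_div_of_nonneg_left hpos.le (hpos.trans_le (socialWelfare_le_iSup _ _))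
      (ciSup_le fun j => socialWelfare_le_card h j)

end Distortion

theorem integrable_distortion {D : Measure ℝ} [IsProbabilityMeasure D]
    (hD : ∀ᵐ x ∂D, x ∈ Set.Icc (0 : ℝ) 1) {n m : ℕ} (f : VotingRule n m) (σ : Profile n m) :
    Integrable (distortion f σ) (drawLaw D n m) := by
  refine Integrable.of_mem_Icc 0 1 (measurable_distortion f σ).aemeasurable ?_
  filter_upwards [ae_utilities_mem_Icc hD σ] with X hX using distortion_mem_Icc f hX

theorem expectedDistortion_mem_Icc {D : Measure ℝ} [IsProbabilityMeasure D]
    (hD : ∀ᵐ x ∂D, x ∈ Set.Icc (0 : ℝ) 1) {n m : ℕ} (f : VotingRule n m) (σ : Profile n m) :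
    expectedDistortion D f σ ∈ Set.Icc (0 : ℝ) 1 := by
  constructor
  · refine integral_nonneg_of_ae ?_
    filter_upwards [ae_utilities_mem_Icc hD σ] with X hX using (distortion_mem_Icc f hX).1
  · refine (integral_mono_ae (integrable_distortion hD f σ) (integrable_const 1) ?_).trans_eq
      (by simp)
    filter_upwards [ae_utilities_mem_Icc hD σ] with X hX using (distortion_mem_Icc f hX).2

/-- Social welfare is at most the number of voters, so the expected distortion of binomial voting is
at least its expected average utility, which is at least half of the largest median. -/
theorem IsBinomialVoting.half_largestMedian_le_expectedDistortion {n m : ℕ} (hn : 1 ≤ n)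
    (hm : 1 ≤ m) {f : VotingRule n m} (hf : IsBinomialVoting f) {D : Measure ℝ}
    [IsProbabilityMeasure D] (hD : ∀ᵐ x ∂D, x ∈ Set.Icc (0 : ℝ) 1) (σ : Profile n m) :
    largestMedian D / 2 ≤ expectedDistortion D f σ := by
  have hn' : (0 : ℝ) < n := by exact_mod_cast hn
  have hint : Integrable (fun X => socialWelfare (utilities σ X) (f σ)) (drawLaw D n m) :=
    integrable_finsetSum _ fun i _ => integrable_utilities hD σ i (f σ)
  calc largestMedian D / 2
      ≤ (∫ X, socialWelfare (utilities σ X) (f σ) ∂(drawLaw D n m)) / n := by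
        rw [le_div_iff₀ hn', mul_comm]
        exact hf.le_integral_socialWelfare hm hD σ
    _ = ∫ X, socialWelfare (utilities σ X) (f σ) / n ∂(drawLaw D n m) := (integral_div _ _).symm
    _ ≤ expectedDistortion D f σ := by
        refine integral_mono_ae (hint.div_const _) (integrable_distortion hD f σ) ?_
        filter_upwards [ae_utilities_mem_Icc hD σ] with X hX
          using socialWelfare_div_card_le_distortion f hX

theorem IsBinomialVoting.isApproxEDMR {n m : ℕ} (hn : 1 ≤ n) (hm : 1 ≤ m) {f : VotingRule n m}
    (hf : IsBinomialVoting f) {D : Measure ℝ} [IsProbabilityMeasure D]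
    (hD : ∀ᵐ x ∂D, x ∈ Set.Icc (0 : ℝ) 1) {ε : ℝ} (hε : 0 ≤ ε) :
    IsApproxEDMR ((1 / 2 - ε) * largestMedian D) D f := by
  intro e _ σ
  have he := expectedDistortion_mem_Icc hD e σ
  have hν := largestMedian_nonneg hD
  calc (1 / 2 - ε) * largestMedian D * expectedDistortion D e σ
      ≤ largestMedian D / 2 * expectedDistortion D e σ := by
        refine mul_le_mul_of_nonneg_right ?_ he.1
        nlinarith [mul_nonneg hε hν]
    _ ≤ largestMedian D / 2 := mul_le_of_le_one_right (by linarith) he.2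
    _ ≤ expectedDistortion D f σ := hf.half_largestMedian_le_expectedDistortion hn hm hD σ

end DistVoting

theorem mainTheorem4 (μ v ν ε : ℝ) (hε : 0 < ε) :
    (∃ n₀ : ℕ, ∀ (D : MeasureTheory.Measure ℝ) [MeasureTheory.IsProbabilityMeasure D],
      (∀ᵐ x ∂D, x ∈ Set.Icc (0 : ℝ) 1) → ∫ x, x ∂D = μ →
      ProbabilityTheory.variance (fun x => x) D = v → DistVoting.largestMedian D = ν →
      ∀ n m : ℕ, 1 ≤ n → 1 ≤ m → n₀ ≤ n →
      ∀ f : DistVoting.VotingRule n m, DistVoting.IsBinomialVoting f →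
        DistVoting.IsApproxEDMR ((1 / 2 - ε) * ν) D f) ∧
    (∀ (D : MeasureTheory.Measure ℝ) [MeasureTheory.IsProbabilityMeasure D],
      (∀ᵐ x ∂D, x ∈ Set.Icc (0 : ℝ) 1) → ∫ x, x ∂D = μ →
      ProbabilityTheory.variance (fun x => x) D = v → DistVoting.largestMedian D = ν →
      DistVoting.HasC1CdfBoundedBelow D →
      ∃ m₀ : ℕ, ∀ n m : ℕ, 1 ≤ n → 1 ≤ m → m₀ ≤ m →
      ∀ f : DistVoting.VotingRule n m, DistVoting.IsBinomialVoting f →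
        DistVoting.IsApproxEDMR ((1 / 2 - ε) * ν) D f) := by
  -- The bound holds for all positive `n` and `m`, so both thresholds can be 0.
  refine ⟨⟨0, fun D _ hD _ _ hν n m hn hm _ f hf => ?_⟩,
    fun D _ hD _ _ hν _ => ⟨0, fun n m hn hm _ f hf => ?_⟩⟩
  all_goals
    rw [← hν]
    exact hf.isApproxEDMR hn hm hD hε.le
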